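/- Let $\alpha>0$. For $t>0$ put $w(x,t)=(1-x^2)^\alpha e^{-t/x^2}$, $x\in[-1,1]$, let $P_n(x,t)$, $n=0,1,2,\dots$, be the monic polynomials of degree $n$ (in $x$) that are orthogonal on $[-1,1]$ with respect to $w(x,t)\,dx$, and let $h_n(t)=\int_{-1}^{1}P_n(x,t)^2\,w(x,t)\,dx$. Define $r_0(t)=0$ and, for $n\ge 1$, $$r_n(t)=\frac{2t}{h_{n-1}(t)}\int_{-1}^{1}\frac{P_n(y,t)P_{n-1}(y,t)\,w(y,t)}{y^3}\,dy .$$ Then for every integer $n\ge 0$ the function $r_n$ is twice differentiable on $(0,\infty)$, and for every $t>0$ it satisfies, with $r_n=r_n(t)$, $r_n'=r_n'(t)$, $r_n''=r_n''(t)$, $$ \begin{aligned} &4t^3(r_n'')^2+4t^2\big[r_n'-2(-1)^n\big(3r_n^2+4(n+\alpha)r_n+n(n+2\alpha)\big)\big]r_n''\\ &-t\big[4r_n^2-8(-1)^n t\,r_n+4t^2-1\big](r_n')^2-4(-1)^n t\big[3r_n^2+4(n+\alpha)r_n+n(n+2\alpha)\big]r_n'\\ &+8(-1)^n r_n^5+4\big[4(-1)^n(n+\alpha)+5t\big]r_n^4+8\big[(-1)^n(n^2+2n\alpha+t^2)+8t(n+\alpha)\big]r_n^3\\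 &+8t\big[2(-1)^n t(n+\alpha)+(3n+2\alpha)(3n+4\alpha)\big]r_n^2+8n(n+2\alpha)t\big[4n+4\alpha+(-1)^n t\big]r_n\\ &+4n^2(n+2\alpha)^2t=0 . \end{aligned} $$ -/

import Mathlib

open Polynomial MeasureTheory

noncomputable section

namespace SingJacobi

/-- The singularly perturbed symmetric Jacobi weight on `[-1, 1]`. Its value at the single point `x = 0`
(where Lean reads `t / 0` as `0`) is irrelevant, since the weight only occurs under integrals. -/
def weight (α t x : ℝ) : ℝ := (1 - x ^ 2) ^ α * Real.exp (-(t / x ^ 2))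

/-- The inner product of two polynomials with respect to the weight. -/
def ip (α t : ℝ) (p q : ℝ[X]) : ℝ :=
  ∫ x in (-1 : ℝ)..1, p.eval x * q.eval x * weight α t x

/-- The monic orthogonal polynomials `P_n(x, t)`, built by the Gram-Schmidt process. The facts
`monicOP_monic`, `monicOP_natDegree` and `monicOP_orthogonal` below state the properties which
characterize them. -/
def monicOP (α t : ℝ) (n : ℕ) : ℝ[X] :=
  X ^ n - ∑ j : Fin n,
    C (ip α t (X ^ n) (monicOP α t j) / ip α t (monicOP α t j) (monicOP α t j)) * monicOP α t j
termination_by n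
decreasing_by exact j.2

/-- The squared norms `h_n(t)`. -/
def sqNorm (α t : ℝ) (n : ℕ) : ℝ := ip α t (monicOP α t n) (monicOP α t n)

/-- The quantity `r_n(t)`, with the convention `r_0(t) = 0`. -/
def rAux (α : ℝ) : ℕ → ℝ → ℝ
  | 0, _ => 0
  | m + 1, t => 2 * t / sqNorm α t m *
      ∫ y in (-1 : ℝ)..1,
        (monicOP α t (m + 1)).eval y * (monicOP α t m).eval y * weight α t y / y ^ 3

/-! The integrals above converge, and the polynomials have the defining properties. -/

theorem weight_nonneg {α t x : ℝ} (hx : |x| ≤ 1) : 0 ≤ weight α t x := by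
  have : x ^ 2 ≤ 1 := (sq_le_one_iff_abs_le_one x).2 hx
  exact mul_nonneg (Real.rpow_nonneg (by linarith) _) (Real.exp_pos _).le

theorem measurable_weight (α t : ℝ) : Measurable (weight α t) := by
  unfold weight
  fun_prop

theorem weight_le_exp {α t x : ℝ} (hα : 0 < α) (hx : |x| ≤ 1) :
    weight α t x ≤ Real.exp (-(t / x ^ 2)) := by
  have : x ^ 2 ≤ 1 := (sq_le_one_iff_abs_le_one x).2 hx
  have h1 : (1 - x ^ 2) ^ α ≤ 1 :=
    Real.rpow_le_one (by linarith) (by nlinarith [sq_nonneg x]) hα.le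
  exact mul_le_of_le_one_left (Real.exp_pos _).le h1

theorem intervalIntegrable_of_bound {f : ℝ → ℝ} (hf : Measurable f) (C : ℝ)
    (hC : ∀ x, |x| ≤ 1 → |f x| ≤ C) : IntervalIntegrable f volume (-1) 1 := by
  rw [intervalIntegrable_iff_integrableOn_Ioc_of_le (by norm_num)]
  refine Measure.integrableOn_of_bounded (M := C) (by simp) hf.aestronglyMeasurable ?_
  refine (ae_restrict_mem measurableSet_Ioc).mono fun x hx => ?_
  exact hC x (abs_le.2 ⟨hx.1.le, hx.2⟩)

theorem exists_eval_bound (p : ℝ[X]) : ∃ C, 0 ≤ C ∧ ∀ x : ℝ, |x| ≤ 1 → |p.eval x| ≤ C := by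
  obtain ⟨C, hC⟩ := (isCompact_Icc (a := (-1 : ℝ)) (b := 1)).exists_bound_of_continuousOn
    p.continuous.continuousOn
  exact ⟨C, (abs_nonneg _).trans (hC 0 (by simp)), fun x hx => hC x (abs_le.1 hx)⟩

theorem intervalIntegrable_ip {α t : ℝ} (hα : 0 < α) (ht : 0 < t) (p q : ℝ[X]) :
    IntervalIntegrable (fun x => p.eval x * q.eval x * weight α t x) volume (-1) 1 := by
  obtain ⟨A, hA0, hA⟩ := exists_eval_bound (p * q)
  refine intervalIntegrable_of_bound
    ((p.continuous.measurable.mul q.continuous.measurable).mul (measurable_weight α t)) A ?_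
  intro x hx
  have h1 := hA x hx
  rw [eval_mul] at h1
  have h2 : weight α t x ≤ 1 :=
    (weight_le_exp hα hx).trans (Real.exp_le_one_iff.2 (neg_nonpos.2 (by positivity)))
  rw [abs_mul, abs_of_nonneg (weight_nonneg hx)]
  exact (mul_le_mul h1 h2 (weight_nonneg hx) hA0).trans (by simp)

theorem intervalIntegrable_rAux {α t : ℝ} (hα : 0 < α) (ht : 0 < t) (p q : ℝ[X]) :
    IntervalIntegrable (fun y => p.eval y * q.eval y * weight α t y / y ^ 3) volume (-1) 1 := by
  obtain ⟨A, hA0, hA⟩ := exists_eval_bound (p * q)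
  refine intervalIntegrable_of_bound
    (((p.continuous.measurable.mul q.continuous.measurable).mul (measurable_weight α t)).div
      (by fun_prop)) (A * (2 / t ^ 2)) ?_
  intro y hy
  have h1 := hA y hy
  rw [eval_mul] at h1
  rw [mul_div_assoc, abs_mul]
  refine mul_le_mul h1 ?_ (abs_nonneg _) hA0
  by_cases h0 : y = 0
  · subst h0
    simp
    positivity
  have hpos : 0 < |y| := abs_pos.2 h0
  rw [abs_div, abs_of_nonneg (weight_nonneg hy), abs_pow, div_le_iff₀ (by positivity)]
  refine (weight_le_exp hα hy).trans ?_
  rw [← sq_abs y, Real.exp_neg]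
  have hu : 0 ≤ t / |y| ^ 2 := by positivity
  have hq := Real.quadratic_le_exp_of_nonneg hu
  have h2 : (t / |y| ^ 2) ^ 2 / 2 ≤ Real.exp (t / |y| ^ 2) := by linarith
  calc (Real.exp (t / |y| ^ 2))⁻¹ ≤ ((t / |y| ^ 2) ^ 2 / 2)⁻¹ :=
        inv_anti₀ (by positivity) h2
    _ = 2 / t ^ 2 * |y| ^ 4 := by
        field_simp
    _ ≤ 2 / t ^ 2 * |y| ^ 3 := by
        refine mul_le_mul_of_nonneg_left ?_ (by positivity)
        exact pow_le_pow_of_le_one hpos.le hy (by norm_num)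

theorem ip_comm (α t : ℝ) (p q : ℝ[X]) : ip α t p q = ip α t q p := by
  unfold ip
  simp only [mul_comm (eval _ p)]

theorem ip_sub_left {α t : ℝ} (hα : 0 < α) (ht : 0 < t) (p q r : ℝ[X]) :
    ip α t (p - q) r = ip α t p r - ip α t q r := by
  unfold ip
  rw [← intervalIntegral.integral_sub (intervalIntegrable_ip hα ht p r)
    (intervalIntegrable_ip hα ht q r)]
  simp only [eval_sub, sub_mul]

theorem ip_C_mul_left (α t c : ℝ) (p r : ℝ[X]) :
    ip α t (C c * p) r = c * ip α t p r := by
  unfold ip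
  rw [← intervalIntegral.integral_const_mul]
  simp only [eval_mul, eval_C, mul_assoc]

theorem ip_sum_left {α t : ℝ} (hα : 0 < α) (ht : 0 < t) {ι : Type*} (s : Finset ι)
    (f : ι → ℝ[X]) (r : ℝ[X]) : ip α t (∑ i ∈ s, f i) r = ∑ i ∈ s, ip α t (f i) r := by
  unfold ip
  rw [← intervalIntegral.integral_finsetSum fun i _ => intervalIntegrable_ip hα ht (f i) r]
  simp only [eval_finsetSum, Finset.sum_mul]

theorem ip_self_pos {α t : ℝ} (hα : 0 < α) (ht : 0 < t) {p : ℝ[X]} (hp : p ≠ 0) :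
    0 < ip α t p p := by
  unfold ip
  rw [intervalIntegral.integral_pos_iff_support_of_nonneg_ae' ?_ (intervalIntegrable_ip hα ht p p)]
  · refine ⟨by norm_num, ?_⟩
    have hsub : Set.Ioo (-1 : ℝ) 1 \ (p.roots.toFinset : Set ℝ) ⊆
        Function.support (fun x => p.eval x * p.eval x * weight α t x) ∩ Set.Ioc (-1) 1 := by
      rintro x ⟨hx, hr⟩
      refine ⟨?_, hx.1, hx.2.le⟩
      have h1 : p.eval x ≠ 0 := by
        intro h
        exact hr (by simp [hp, h])
      have h2 : 0 < weight α t x :=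
        mul_pos (Real.rpow_pos_of_pos (by nlinarith [hx.1, hx.2]) _) (Real.exp_pos _)
      exact mul_ne_zero (mul_ne_zero h1 h1) h2.ne'
    refine lt_of_lt_of_le ?_ (measure_mono hsub)
    rw [measure_sdiff_null (p.roots.toFinset.finite_toSet.measure_zero _)]
    simp
  · rw [Set.uIoc_of_le (by norm_num)]
    refine (ae_restrict_mem measurableSet_Ioc).mono fun x hx => ?_
    exact mul_nonneg (mul_self_nonneg _) (weight_nonneg (abs_le.2 ⟨hx.1.le, hx.2⟩))

theorem monicOP_monic_natDegree (α t : ℝ) (n : ℕ) :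
    (monicOP α t n).Monic ∧ (monicOP α t n).natDegree = n := by
  induction n using Nat.strong_induction_on with
  | _ n ih =>
    have hdeg : (∑ j : Fin n, C (ip α t (X ^ n) (monicOP α t j) /
        ip α t (monicOP α t j) (monicOP α t j)) * monicOP α t j).degree < (n : WithBot ℕ) := by
      refine (degree_sum_le _ _).trans_lt ?_
      refine (Finset.sup_lt_iff (WithBot.bot_lt_coe n)).2 fun j _ => ?_
      refine ((degree_mul_le _ _).trans (add_le_of_nonpos_left degree_C_le)).trans_lt
        (degree_le_natDegree.trans_lt ?_)
      rw [(ih j j.2).2]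
      exact Nat.cast_lt.2 j.2
    have hX : (X ^ n : ℝ[X]).degree = n := degree_X_pow n
    rw [monicOP]
    refine ⟨(monic_X_pow n).sub_of_left (by rwa [hX]), ?_⟩
    refine natDegree_eq_of_degree_eq_some ?_
    rw [degree_sub_eq_left_of_degree_lt (by rwa [hX]), hX]

theorem monicOP_monic (α t : ℝ) (n : ℕ) : (monicOP α t n).Monic :=
  (monicOP_monic_natDegree α t n).1

theorem monicOP_natDegree (α t : ℝ) (n : ℕ) : (monicOP α t n).natDegree = n :=
  (monicOP_monic_natDegree α t n).2

theorem sqNorm_pos {α t : ℝ} (hα : 0 < α) (ht : 0 < t) (n : ℕ) : 0 < sqNorm α t n :=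
  ip_self_pos hα ht (monicOP_monic α t n).ne_zero

theorem monicOP_orthogonal {α t : ℝ} (hα : 0 < α) (ht : 0 < t) {m n : ℕ} (hmn : m ≠ n) :
    ip α t (monicOP α t m) (monicOP α t n) = 0 := by
  have key : ∀ n : ℕ, ∀ m < n, ip α t (monicOP α t n) (monicOP α t m) = 0 := by
    intro n
    induction n using Nat.strong_induction_on with
    | _ n ih =>
      intro m hm
      rw [monicOP, ip_sub_left hα ht, ip_sum_left hα ht,
        Finset.sum_eq_single (⟨m, hm⟩ : Fin n)]
      · have h0 : ip α t (monicOP α t m) (monicOP α t m) ≠ 0 := (sqNorm_pos hα ht m).ne'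
        rw [ip_C_mul_left, div_mul_cancel₀ _ h0, sub_self]
      · intro j _ hj
        rw [ip_C_mul_left]
        have hne : (j : ℕ) ≠ m := fun h => hj (Fin.ext h)
        rcases lt_or_gt_of_ne hne with h | h
        · rw [ip_comm α t (monicOP α t j) (monicOP α t m), ih m hm j h, mul_zero]
        · rw [ih j j.2 m h, mul_zero]
      · simp
  rcases lt_or_gt_of_ne hmn with h | h
  · rw [ip_comm]
    exact key n m h
  · exact key m n h

end SingJacobi

end

/-! Write β_n for `recCoeff`, R_n for `ladderR` and s = (-1)^n. The three-term recurrence gives r_n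
+ r_{n+1} = R_n and β_{n+1} R_{n+1} - β_n R_{n-1} = 2st, while integration by parts against the
weight expresses r_n through β_0, ..., β_n (`rAux_eq`). Multiplied by R_n or by R_n + 2n + 2α + 1,
these difference relations telescope to two first integrals, `recCoeff_mul_ladderR_mul` and
`recCoeff_mul_shifted`.

In the variable t, orthogonality gives h_n' = -h_n R_n / (2t), hence a Toda equation for β_n, and 2t
r_n' becomes β_n ((2n+2α+1) R_{n-1} - (2n+2α-1) R_n). Let S be the same expression with a plus sign.
Then S² - (2t r_n')² is a multiple of β_n² R_n R_{n-1}, which the first integrals turn into an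
expression in r_n, t and S. The Riccati equation `hasDerivAt_ladderR` makes 2t² r_n'' + t r_n'
affine in S with slope r_n - st. Eliminating S gives the differential equation
(`quadratic_ode_of_relations`). -/

noncomputable section

namespace SingJacobi

/-! ### Integrals against the weight: derivative in t, integration by parts -/

/-- The linear functional `p ↦ ∫ p(y) w(y) y⁻³ dy`, in terms of which all the integrals of polynomials
against `w`, `w / y`, `w / y²` and `w / y³` can be written. -/
def cubeInt (α t : ℝ) (p : ℝ[X]) : ℝ :=
  ∫ y in (-1 : ℝ)..1, p.eval y * weight α t y / y ^ 3

theorem intervalIntegrable_cubeInt {α t : ℝ} (hα : 0 < α) (ht : 0 < t) (p : ℝ[X]) :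
    IntervalIntegrable (fun y => p.eval y * weight α t y / y ^ 3) volume (-1) 1 := by
  simpa using intervalIntegrable_rAux hα ht p 1

theorem cubeInt_add {α t : ℝ} (hα : 0 < α) (ht : 0 < t) (p q : ℝ[X]) :
    cubeInt α t (p + q) = cubeInt α t p + cubeInt α t q := by
  unfold cubeInt
  rw [← intervalIntegral.integral_add (intervalIntegrable_cubeInt hα ht p)
    (intervalIntegrable_cubeInt hα ht q)]
  simp only [eval_add, add_mul, add_div]

theorem cubeInt_C_mul (α t c : ℝ) (p : ℝ[X]) :
    cubeInt α t (C c * p) = c * cubeInt α t p := by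
  unfold cubeInt
  rw [← intervalIntegral.integral_const_mul]
  simp only [eval_mul, eval_C, mul_assoc, mul_div_assoc]

theorem cubeInt_sub {α t : ℝ} (hα : 0 < α) (ht : 0 < t) (p q : ℝ[X]) :
    cubeInt α t (p - q) = cubeInt α t p - cubeInt α t q := by
  have h : p - q = p + C (-1) * q := by simp [sub_eq_add_neg]
  rw [h, cubeInt_add hα ht, cubeInt_C_mul]
  ring

theorem ae_ne_zero : ∀ᵐ y : ℝ, y ≠ 0 := by
  simp [ae_iff]

theorem ip_eq_cubeInt (α t : ℝ) (p q : ℝ[X]) : ip α t p q = cubeInt α t (X ^ 3 * (p * q)) := by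
  unfold ip cubeInt
  refine intervalIntegral.integral_congr_ae (ae_ne_zero.mono fun y hy _ => ?_)
  simp only [eval_mul, eval_pow, eval_X]
  field_simp

theorem ip_comp_neg_X (α t : ℝ) (p q : ℝ[X]) :
    ip α t (p.comp (-X)) q = ip α t p (q.comp (-X)) := by
  unfold ip
  have h := intervalIntegral.integral_comp_neg (a := -1) (b := 1)
    (fun x => (p.comp (-X)).eval x * q.eval x * weight α t x)
  rw [neg_neg] at h
  rw [← h]
  simp [eval_comp, weight]

theorem hasDerivAt_exp_neg_div (x t : ℝ) :
    HasDerivAt (fun t => Real.exp (-(t / x ^ 2))) (-(Real.exp (-(t / x ^ 2)) / x ^ 2)) t := by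
  have h := ((hasDerivAt_id t).div_const (x ^ 2)).neg.exp
  refine h.congr_deriv ?_
  simp
  ring

/-- From u ≤ exp u at u = s / x². It supplies the dominating constant for differentiating under the
integral. -/
theorem exp_neg_div_sq_le {s x : ℝ} (hs : 0 < s) :
    Real.exp (-(s / x ^ 2)) / x ^ 2 ≤ 1 / s := by
  rcases eq_or_ne x 0 with rfl | hx
  · simp [hs.le]
  have h1 : s / x ^ 2 ≤ Real.exp (s / x ^ 2) := by linarith [Real.add_one_le_exp (s / x ^ 2)]
  have hx2 : 0 < x ^ 2 := by positivity
  rw [Real.exp_neg, div_le_div_iff₀ hx2 hs, one_mul, inv_mul_le_iff₀ (Real.exp_pos _)]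
  rwa [div_le_iff₀ hx2] at h1

theorem hasDerivAt_ip {α t : ℝ} (hα : 0 < α) (ht : 0 < t) (p q : ℝ[X]) :
    HasDerivAt (fun s => ip α s p q) (-cubeInt α t (X * (p * q))) t := by
  obtain ⟨A, hA0, hA⟩ := exists_eval_bound (p * q)
  have key := (intervalIntegral.hasDerivAt_integral_of_dominated_loc_of_deriv_le
    (a := -1) (b := 1) (μ := volume)
    (F := fun s x => p.eval x * q.eval x * weight α s x)
    (F' := fun s x => p.eval x * q.eval x *
      ((1 - x ^ 2) ^ α * -(Real.exp (-(s / x ^ 2)) / x ^ 2)))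
    (x₀ := t) (s := Set.Ioi (t / 2)) (bound := fun _ => A * (1 / (t / 2)))
    -- Staying in s > t/2 keeps s away from 0, so the bound 1/s is uniform.
    (Ioi_mem_nhds (by linarith))
    (Filter.Eventually.of_forall fun s => ?_) (intervalIntegrable_ip hα ht p q) ?_ ?_ (by simp)
    ?_).2
  · refine key.congr_deriv ?_
    unfold cubeInt
    rw [← intervalIntegral.integral_neg]
    refine intervalIntegral.integral_congr_ae (ae_ne_zero.mono fun y hy _ => ?_)
    simp only [eval_mul, eval_X, weight]
    field_simp
  · exact ((p.continuous.measurable.mul q.continuous.measurable).mul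
      (measurable_weight α s)).aestronglyMeasurable
  · exact Measurable.aestronglyMeasurable (by fun_prop)
  · refine Filter.Eventually.of_forall fun x hx s hs => ?_
    rw [Set.uIoc_of_le (by norm_num)] at hx
    have hx1 : |x| ≤ 1 := abs_le.2 ⟨hx.1.le, hx.2⟩
    have hx2 : x ^ 2 ≤ 1 := (sq_le_one_iff_abs_le_one x).2 hx1
    have hs0 : t / 2 < s := hs
    have h1 := hA x hx1
    rw [eval_mul] at h1
    rw [norm_mul, Real.norm_eq_abs]
    refine mul_le_mul h1 ?_ (norm_nonneg _) hA0
    have h2 : 0 ≤ (1 - x ^ 2) ^ α := Real.rpow_nonneg (by linarith) _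
    have h3 : (1 - x ^ 2) ^ α ≤ 1 := Real.rpow_le_one (by linarith) (by nlinarith [sq_nonneg x]) hα.le
    have h4 : 0 ≤ Real.exp (-(s / x ^ 2)) / x ^ 2 := by positivity
    rw [norm_mul, norm_neg, Real.norm_of_nonneg h2, Real.norm_of_nonneg h4]
    refine (mul_le_of_le_one_left h4 h3).trans ((exp_neg_div_sq_le (by linarith)).trans ?_)
    exact one_div_le_one_div_of_le (by linarith) hs0.le
  · refine Filter.Eventually.of_forall fun x _ s _ => ?_
    exact ((hasDerivAt_exp_neg_div x s).const_mul _).const_mul _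

/-- Integration by parts against the weight. -/
theorem cubeInt_pearson {α t : ℝ} (hα : 0 < α) (ht : 0 < t) (g : ℝ[X]) :
    cubeInt α t (X ^ 3 * ((1 - X ^ 2) * derivative g) - C (2 * (1 + α)) * (X ^ 3 * (X * g)) +
      C (2 * t) * ((1 - X ^ 2) * g)) = 0 := by
  -- `expNegInvGlue` vanishes at 0, which makes the primitive continuous there; the literal exp(-(t
  -- / 0)) equals 1 and would not do.
  have hcont : Continuous fun x : ℝ => expNegInvGlue (x ^ 2 / t) :=
    expNegInvGlue.contDiff (n := 0).continuous.comp (by fun_prop)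
  have hexp : ∀ x : ℝ, x ≠ 0 → expNegInvGlue (x ^ 2 / t) = Real.exp (-(t / x ^ 2)) := by
    intro x hx
    have : 0 < x ^ 2 / t := by positivity
    rw [expNegInvGlue, if_neg this.not_ge, inv_div]
  have h := integral_eq_of_hasDerivAt_off_countable_of_le
    (fun x : ℝ => g.eval x * ((1 - x ^ 2) ^ (α + 1) * expNegInvGlue (x ^ 2 / t)))
    (fun x : ℝ => (X ^ 3 * ((1 - X ^ 2) * derivative g) - C (2 * (1 + α)) * (X ^ 3 * (X * g)) +
      C (2 * t) * ((1 - X ^ 2) * g)).eval x * weight α t x / x ^ 3)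
    (a := -1) (b := 1) (by norm_num) (Set.countable_singleton (0 : ℝ)) ?_ ?_
    (intervalIntegrable_cubeInt hα ht _)
  · rw [cubeInt, h]
    -- The primitive g (1 - x²) w vanishes at both endpoints.
    have h0 : (0 : ℝ) ^ (α + 1) = 0 := Real.zero_rpow (by linarith)
    norm_num [h0]
  · refine (g.continuous.mul (Continuous.mul ?_ hcont)).continuousOn
    exact Continuous.rpow_const (by fun_prop) fun x => Or.inr (by linarith)
  · rintro x ⟨hx, hx0⟩
    have hx0 : x ≠ 0 := hx0
    have hpos : 0 < 1 - x ^ 2 := by nlinarith [hx.1, hx.2]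
    have d1 : HasDerivAt (fun x : ℝ => (1 - x ^ 2) ^ (α + 1))
        (-(2 * x) * (α + 1) * (1 - x ^ 2) ^ α) x := by
      have := ((hasDerivAt_pow 2 x).const_sub 1).rpow_const (p := α + 1) (Or.inl hpos.ne')
      simpa using this
    have d2 : HasDerivAt (fun x : ℝ => expNegInvGlue (x ^ 2 / t))
        (Real.exp (-(t / x ^ 2)) * (2 * t / x ^ 3)) x := by
      have e1 : HasDerivAt (fun x : ℝ => Real.exp (-(t / x ^ 2)))
          (Real.exp (-(t / x ^ 2)) * (2 * t / x ^ 3)) x := by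
        have := (((hasDerivAt_const x t).div (hasDerivAt_pow 2 x) (by positivity)).neg).exp
        refine this.congr_deriv ?_
        simp only [Pi.neg_apply, Pi.div_apply]
        field_simp
        push_cast
        ring
      refine e1.congr_of_eventuallyEq ?_
      filter_upwards [isOpen_ne.mem_nhds hx0] with y hy using hexp y hy
    refine ((g.hasDerivAt x).mul (d1.mul d2)).congr_deriv ?_
    rw [Pi.mul_apply, hexp x hx0, Real.rpow_add_one hpos.ne']
    simp only [eval_mul, eval_sub, eval_add, eval_pow, eval_X, eval_C, eval_one, weight]
    field_simp
    ring

/-! ### Orthogonality, parity and the three-term recurrence -/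

theorem coeff_monicOP_self (α t : ℝ) (n : ℕ) : (monicOP α t n).coeff n = 1 := by
  have := (monicOP_monic α t n).coeff_natDegree
  rwa [monicOP_natDegree] at this

theorem coeff_monicOP_of_lt (α t : ℝ) {n k : ℕ} (h : n < k) : (monicOP α t n).coeff k = 0 :=
  coeff_eq_zero_of_natDegree_lt (by rwa [monicOP_natDegree])

/-- If `q` is orthogonal to the first `m` orthogonal polynomials, it is orthogonal to all
polynomials of degree less than `m`. -/
theorem ip_eq_zero_of_degree_lt {α t : ℝ} (hα : 0 < α) (ht : 0 < t) (q : ℝ[X]) (m : ℕ)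
    (h : ∀ j < m, ip α t (monicOP α t j) q = 0) (p : ℝ[X]) (hp : p.degree < m) :
    ip α t p q = 0 := by
  induction m generalizing p with
  | zero =>
    have : p = 0 := by simpa [Nat.WithBot.lt_zero_iff] using hp
    simp [this, ip]
  | succ m ih =>
    have h1 : (p - C (p.coeff m) * monicOP α t m).degree < (m : WithBot ℕ) := by
      rw [degree_lt_iff_coeff_zero] at hp ⊢
      intro k hk
      rw [coeff_sub, coeff_C_mul]
      rcases hk.eq_or_lt with rfl | hk
      · rw [coeff_monicOP_self]
        ring
      · rw [hp k hk, coeff_monicOP_of_lt α t hk]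
        ring
    have h2 := ih (fun j hj => h j (by omega)) _ h1
    rw [ip_sub_left hα ht, ip_C_mul_left, h m (by omega)] at h2
    linarith

theorem eq_zero_of_ip_eq_zero {α t : ℝ} (hα : 0 < α) (ht : 0 < t) {q : ℝ[X]} {m : ℕ}
    (hq : q.degree < m) (h : ∀ j < m, ip α t (monicOP α t j) q = 0) : q = 0 := by
  by_contra hne
  exact (ip_self_pos hα ht hne).ne' (ip_eq_zero_of_degree_lt hα ht q m h q hq)

/-- A polynomial of degree at most `n` pairs with `P_n` through its coefficient of `x^n`. -/
theorem ip_monicOP {α t : ℝ} (hα : 0 < α) (ht : 0 < t) {n : ℕ} {p : ℝ[X]}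
    (hp : ∀ k, n < k → p.coeff k = 0) :
    ip α t p (monicOP α t n) = p.coeff n * sqNorm α t n := by
  have h1 : (p - C (p.coeff n) * monicOP α t n).degree < (n : WithBot ℕ) := by
    rw [degree_lt_iff_coeff_zero]
    intro k hk
    rw [coeff_sub, coeff_C_mul]
    rcases hk.eq_or_lt with rfl | hk
    · rw [coeff_monicOP_self]
      ring
    · rw [hp k hk, coeff_monicOP_of_lt α t hk]
      ring
  have h2 := ip_eq_zero_of_degree_lt hα ht (monicOP α t n) n
    (fun j hj => monicOP_orthogonal hα ht hj.ne) _ h1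
  rw [ip_sub_left hα ht, ip_C_mul_left] at h2
  rw [sqNorm]
  linarith

theorem coeff_comp_neg_X (p : ℝ[X]) (k : ℕ) : (p.comp (-X)).coeff k = (-1) ^ k * p.coeff k := by
  have h : (-X : ℝ[X]) = C (-1) * X := by simp
  rw [h, comp_C_mul_X_coeff, mul_comm]

/-- The weight is even, so both sides are orthogonal to lower degrees and have the same leading
coefficient; their difference has degree below n and is orthogonal to itself. -/
theorem monicOP_comp_neg_X {α t : ℝ} (hα : 0 < α) (ht : 0 < t) (n : ℕ) :
    (monicOP α t n).comp (-X) = C ((-1) ^ n) * monicOP α t n := by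
  rw [← sub_eq_zero]
  refine eq_zero_of_ip_eq_zero hα ht (m := n) ?_ fun j hj => ?_
  · rw [degree_lt_iff_coeff_zero]
    intro k hk
    rw [coeff_sub, coeff_C_mul, coeff_comp_neg_X]
    rcases hk.eq_or_lt with rfl | hk
    · ring
    · rw [coeff_monicOP_of_lt α t hk]
      ring
  · rw [ip_comm, ip_sub_left hα ht, ip_C_mul_left, monicOP_orthogonal hα ht hj.ne', ip_comp_neg_X,
      ip_comm, ip_monicOP hα ht, coeff_comp_neg_X, coeff_monicOP_of_lt α t hj]
    · ring
    · intro k hk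
      rw [coeff_comp_neg_X, coeff_monicOP_of_lt α t (hj.trans hk), mul_zero]

theorem coeff_monicOP_succ {α t : ℝ} (hα : 0 < α) (ht : 0 < t) (n : ℕ) :
    (monicOP α t (n + 1)).coeff n = 0 := by
  have h := congrArg (fun p => p.coeff n) (monicOP_comp_neg_X hα ht (n + 1))
  simp only [coeff_comp_neg_X, coeff_C_mul, pow_succ] at h
  have h1 : ((-1 : ℝ) ^ n) ≠ 0 := pow_ne_zero _ (by norm_num)
  have h2 : (-1 : ℝ) ^ n * (2 * (monicOP α t (n + 1)).coeff n) = 0 := by linarith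
  simpa [h1] using h2

theorem ip_X_mul (α t : ℝ) (p q : ℝ[X]) : ip α t (X * p) q = ip α t p (X * q) := by
  simp only [ip, eval_mul, eval_X]
  congr 1
  ext x
  ring

theorem ip_X_mul_self {α t : ℝ} (hα : 0 < α) (ht : 0 < t) (n : ℕ) :
    ip α t (X * monicOP α t n) (monicOP α t n) = 0 := by
  have h := ip_comp_neg_X α t ((X * monicOP α t n).comp (-X)) (monicOP α t n)
  have hX : (X * monicOP α t n).comp (-X) = C (-(-1) ^ n) * (X * monicOP α t n) := by
    rw [mul_comp, X_comp, monicOP_comp_neg_X hα ht, C_neg]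
    ring
  rw [comp_neg_X_comp_neg_X, monicOP_comp_neg_X hα ht, hX, ip_C_mul_left, ip_comm α t _ (C _ * _),
    ip_C_mul_left, ip_comm α t (monicOP α t n)] at h
  have hs : ((-1 : ℝ) ^ n) * (-1) ^ n = 1 := by rw [← mul_pow]; norm_num
  linear_combination h / 2 - ip α t (X * monicOP α t n) (monicOP α t n) / 2 * hs

theorem ip_X_mul_succ {α t : ℝ} (hα : 0 < α) (ht : 0 < t) (n : ℕ) :
    ip α t (X * monicOP α t n) (monicOP α t (n + 1)) = sqNorm α t (n + 1) := by
  rw [ip_monicOP hα ht, coeff_X_mul, coeff_monicOP_self, one_mul]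
  intro k hk
  obtain ⟨k, rfl⟩ := Nat.exists_eq_succ_of_ne_zero (by omega : k ≠ 0)
  rw [Nat.succ_eq_add_one, coeff_X_mul, coeff_monicOP_of_lt α t (by omega)]

/-- The recurrence coefficients `β_n = h_n / h_{n-1}`, with `β_0 = 0`. -/
def recCoeff (α : ℝ) : ℕ → ℝ → ℝ
  | 0, _ => 0
  | m + 1, t => sqNorm α t (m + 1) / sqNorm α t m

theorem recCoeff_mul_sqNorm {α t : ℝ} (hα : 0 < α) (ht : 0 < t) (n : ℕ) :
    recCoeff α (n + 1) t * sqNorm α t n = sqNorm α t (n + 1) :=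
  div_mul_cancel₀ _ (sqNorm_pos hα ht n).ne'

theorem monicOP_zero (α t : ℝ) : monicOP α t 0 = 1 :=
  (monicOP_monic α t 0).natDegree_eq_zero.1 (monicOP_natDegree α t 0)

/-- The three-term recurrence. -/
theorem X_mul_monicOP {α t : ℝ} (hα : 0 < α) (ht : 0 < t) (n : ℕ) :
    X * monicOP α t n = monicOP α t (n + 1) + C (recCoeff α n t) * monicOP α t (n - 1) := by
  rw [← sub_eq_zero]
  refine eq_zero_of_ip_eq_zero hα ht (m := n + 1) ?_ fun j hj => ?_
  · rw [degree_lt_iff_coeff_zero]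
    intro k hk
    obtain ⟨k, rfl⟩ := Nat.exists_eq_succ_of_ne_zero (by omega : k ≠ 0)
    rw [Nat.succ_eq_add_one, coeff_sub, coeff_add, coeff_C_mul, coeff_X_mul,
      coeff_monicOP_of_lt α t (by omega : n - 1 < k + 1)]
    rcases (by omega : n ≤ k).eq_or_lt with rfl | hk
    · rw [coeff_monicOP_self, coeff_monicOP_self]
      ring
    · rw [coeff_monicOP_of_lt α t hk, coeff_monicOP_of_lt α t (by omega : n + 1 < k + 1)]
      ring
  · have h1 : X * monicOP α t n - (monicOP α t (n + 1) + C (recCoeff α n t) * monicOP α t (n - 1)) =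
        X * monicOP α t n - monicOP α t (n + 1) - C (recCoeff α n t) * monicOP α t (n - 1) := by
      ring
    rw [ip_comm, h1, ip_sub_left hα ht, ip_sub_left hα ht, ip_C_mul_left,
      monicOP_orthogonal hα ht (by omega : n + 1 ≠ j)]
    rcases (by omega : j = n ∨ j + 1 = n ∨ j + 1 < n) with rfl | rfl | h
    · rw [ip_X_mul_self hα ht]
      -- At index 0 the truncated n - 1 again names P_0; the convention β_0 = 0 removes that term.
      rcases j with _ | j
      · simp [recCoeff]
      · rw [monicOP_orthogonal hα ht (by omega)]
        ring
    · rw [ip_X_mul, ip_comm, ip_X_mul_succ hα ht, Nat.add_sub_cancel, ← sqNorm,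
        recCoeff_mul_sqNorm hα ht]
      ring
    · rw [monicOP_orthogonal hα ht (by omega : n - 1 ≠ j), ip_X_mul, ip_comm, ip_monicOP hα ht]
      · rw [show n = n - 1 + 1 by omega, coeff_X_mul, coeff_monicOP_of_lt α t (by omega)]
        ring
      · intro k hk
        rw [show k = k - 1 + 1 by omega, coeff_X_mul, coeff_monicOP_of_lt α t (by omega)]

/-- The factor X shifts the index, so that the subleading coefficient of P_{n+1} is addressed
without the subtraction n - 1. -/
theorem coeff_X_mul_monicOP {α t : ℝ} (hα : 0 < α) (ht : 0 < t) (n : ℕ) :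
    (X * monicOP α t (n + 1)).coeff n = -∑ j ∈ Finset.range (n + 1), recCoeff α j t := by
  induction n with
  | zero => simp [recCoeff]
  | succ n ih =>
    have h := congrArg (fun p => p.coeff n) (X_mul_monicOP hα ht (n + 1))
    simp only [coeff_add, coeff_C_mul, Nat.add_sub_cancel, coeff_monicOP_self] at h
    rw [Finset.sum_range_succ, coeff_X_mul, neg_add, ← ih, h]
    ring

/-! ### Difference relations between β_n, r_n and R_n, and their first integrals -/

/-- The quantity `R_n = (2 t / h_n) ∫ P_n² w y⁻² dy`. -/
def ladderR (α : ℝ) (n : ℕ) (t : ℝ) : ℝ :=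
  2 * t / sqNorm α t n * cubeInt α t (X * (monicOP α t n * monicOP α t n))

theorem sqNorm_mul_ladderR {α t : ℝ} (hα : 0 < α) (ht : 0 < t) (n : ℕ) :
    sqNorm α t n * ladderR α n t = 2 * t * cubeInt α t (X * (monicOP α t n * monicOP α t n)) := by
  have := (sqNorm_pos hα ht n).ne'
  rw [ladderR]
  field_simp

theorem rAux_succ_mul_sqNorm {α t : ℝ} (hα : 0 < α) (ht : 0 < t) (n : ℕ) :
    rAux α (n + 1) t * sqNorm α t n =
      2 * t * cubeInt α t (monicOP α t (n + 1) * monicOP α t n) := by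
  have := (sqNorm_pos hα ht n).ne'
  simp only [rAux, cubeInt, eval_mul]
  field_simp

theorem rAux_mul_sqNorm {α t : ℝ} (hα : 0 < α) (ht : 0 < t) (n : ℕ) :
    rAux α n t * sqNorm α t n =
      2 * t * (recCoeff α n t * cubeInt α t (monicOP α t n * monicOP α t (n - 1))) := by
  rcases n with _ | n
  · simp [rAux, recCoeff]
  · rw [Nat.add_sub_cancel]
    linear_combination recCoeff α (n + 1) t * rAux_succ_mul_sqNorm hα ht n -
      rAux α (n + 1) t * recCoeff_mul_sqNorm hα ht n

theorem rAux_add_succ {α t : ℝ} (hα : 0 < α) (ht : 0 < t) (n : ℕ) :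
    rAux α n t + rAux α (n + 1) t = ladderR α n t := by
  refine mul_right_cancel₀ (sqNorm_pos hα ht n).ne' ?_
  have h : X * (monicOP α t n * monicOP α t n) = monicOP α t (n + 1) * monicOP α t n +
      C (recCoeff α n t) * (monicOP α t n * monicOP α t (n - 1)) := by
    linear_combination monicOP α t n * X_mul_monicOP hα ht n
  have h1 := sqNorm_mul_ladderR hα ht n
  rw [h, cubeInt_add hα ht, cubeInt_C_mul] at h1
  linear_combination rAux_mul_sqNorm hα ht n + rAux_succ_mul_sqNorm hα ht n - h1

theorem cubeInt_sq_mul_succ_add {α t : ℝ} (hα : 0 < α) (ht : 0 < t) (n : ℕ) :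
    cubeInt α t (X ^ 2 * (monicOP α t (n + 1) * monicOP α t n)) +
      recCoeff α n t * cubeInt α t (X ^ 2 * (monicOP α t n * monicOP α t (n - 1))) =
      sqNorm α t n := by
  rw [← cubeInt_C_mul, ← cubeInt_add hα ht, sqNorm, ip_eq_cubeInt]
  congr 1
  -- Both sides are the integral of P_n (x P_n) w / x, with x P_n expanded by the recurrence on the
  -- left.
  linear_combination -X ^ 2 * monicOP α t n * X_mul_monicOP hα ht n

theorem cubeInt_sq_mul_succ {α t : ℝ} (hα : 0 < α) (ht : 0 < t) (n : ℕ) :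
    cubeInt α t (X ^ 2 * (monicOP α t (n + 1) * monicOP α t n)) =
      sqNorm α t n * (1 + (-1) ^ n) / 2 := by
  induction n with
  | zero =>
    have h := cubeInt_sq_mul_succ_add hα ht 0
    rw [recCoeff, zero_mul, add_zero] at h
    rw [h]
    ring
  | succ n ih =>
    have h := cubeInt_sq_mul_succ_add hα ht (n + 1)
    rw [Nat.add_sub_cancel, ih] at h
    rw [pow_succ (-1 : ℝ)]
    linear_combination h - (1 + (-1) ^ n) / 2 * recCoeff_mul_sqNorm hα ht n

/-- Factor P_{n+1}² - β_n² P_{n-1}² as (P_{n+1} + β_n P_{n-1})(P_{n+1} - β_n P_{n-1}), whose first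
factor is x P_n. This turns integrals against w / y² into integrals against w / y, which are known.
-/
theorem recCoeff_mul_ladderR_sub {α t : ℝ} (hα : 0 < α) (ht : 0 < t) (n : ℕ) :
    recCoeff α (n + 1) t * ladderR α (n + 1) t - recCoeff α n t * ladderR α (n - 1) t =
      2 * (-1) ^ n * t := by
  have hh := (sqNorm_pos hα ht n).ne'
  refine mul_right_cancel₀ hh ?_
  have h1 := sqNorm_mul_ladderR hα ht (n + 1)
  have h2 : sqNorm α t n * (recCoeff α n t * ladderR α (n - 1) t) = 2 * t * (recCoeff α n t ^ 2 *
      cubeInt α t (X * (monicOP α t (n - 1) * monicOP α t (n - 1)))) := by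
    rcases n with _ | n
    · simp [recCoeff]
    · rw [Nat.add_sub_cancel]
      linear_combination recCoeff α (n + 1) t ^ 2 * sqNorm_mul_ladderR hα ht n -
        recCoeff α (n + 1) t * ladderR α n t * recCoeff_mul_sqNorm hα ht n
  have h3 : X * (monicOP α t (n + 1) * monicOP α t (n + 1)) -
      C (recCoeff α n t ^ 2) * (X * (monicOP α t (n - 1) * monicOP α t (n - 1))) =
      X ^ 2 * (monicOP α t (n + 1) * monicOP α t n) -
      C (recCoeff α n t) * (X ^ 2 * (monicOP α t n * monicOP α t (n - 1))) := by
    rw [C_pow]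
    linear_combination -X * (monicOP α t (n + 1) - C (recCoeff α n t) * monicOP α t (n - 1)) *
      X_mul_monicOP hα ht n
  have h4 := congrArg (cubeInt α t) h3
  rw [cubeInt_sub hα ht, cubeInt_sub hα ht, cubeInt_C_mul, cubeInt_C_mul] at h4
  have h5 := cubeInt_sq_mul_succ_add hα ht n
  have h6 := cubeInt_sq_mul_succ hα ht n
  have h7 := recCoeff_mul_sqNorm hα ht n
  linear_combination ladderR α (n + 1) t * h7 + h1 - h2 + 2 * t * h4 - 2 * t * h5 + 4 * t * h6

theorem coeff_X_mul_derivative (p : ℝ[X]) (k : ℕ) :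
    (X * derivative p).coeff k = k * p.coeff k := by
  rcases k with _ | k
  · simp
  · rw [coeff_X_mul, coeff_derivative]
    push_cast
    ring

/-- Integration by parts expresses `r_n` through the recurrence coefficients. -/
theorem rAux_eq {α t : ℝ} (hα : 0 < α) (ht : 0 < t) (n : ℕ) :
    rAux α n t = (2 * n + 2 * α + 1) * recCoeff α n t +
      2 * ∑ j ∈ Finset.range n, recCoeff α j t - n + (1 - (-1) ^ n) * t := by
  rcases n with _ | m
  · simp [rAux, recCoeff]
  have hh := (sqNorm_pos hα ht m).ne'
  refine mul_right_cancel₀ hh ?_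
  set P := monicOP α t (m + 1) with hP
  set Q := monicOP α t m with hQ
  have hPQ : ip α t (X * Q) P = sqNorm α t (m + 1) := ip_X_mul_succ hα ht m
  have i1 : ip α t (derivative Q) P = 0 := by
    rw [hP, ip_monicOP hα ht, coeff_derivative, coeff_monicOP_of_lt α t (by omega)]
    · simp
    · intro k hk
      rw [coeff_derivative, coeff_monicOP_of_lt α t (by omega), zero_mul]
  have i2 : ip α t (X * (X * derivative Q)) P = m * sqNorm α t (m + 1) := by
    rw [hP, ip_monicOP hα ht, coeff_X_mul, coeff_X_mul_derivative, coeff_monicOP_self]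
    · simp
    · intro k hk
      rw [show k = k - 1 + 1 by omega, coeff_X_mul, coeff_X_mul_derivative,
        coeff_monicOP_of_lt α t (by omega), mul_zero]
  have i3 : ip α t (derivative P) Q = (m + 1) * sqNorm α t m := by
    rw [hQ, ip_monicOP hα ht, coeff_derivative, coeff_monicOP_self, one_mul]
    intro k hk
    rw [coeff_derivative, coeff_monicOP_of_lt α t (by omega), zero_mul]
  -- Subtracting (m+1) P cancels the leading term and parity kills the next one, so only the
  -- coefficient giving the sum of the β_j survives.
  have i4 : ip α t (X * (X * derivative P - C (m + 1 : ℝ) * P)) Q =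
      2 * (∑ j ∈ Finset.range (m + 1), recCoeff α j t) * sqNorm α t m := by
    rw [hQ, ip_monicOP hα ht]
    · congr 1
      have h := coeff_X_mul_monicOP hα ht m
      rw [show ∑ j ∈ Finset.range (m + 1), recCoeff α j t = -(X * P).coeff m by rw [h, neg_neg]]
      rcases m with _ | m
      · simp
      · rw [coeff_X_mul, coeff_X_mul, coeff_sub, coeff_X_mul_derivative, coeff_C_mul]
        push_cast
        ring
    · intro k hk
      rw [show k = k - 1 + 1 by omega, coeff_X_mul, coeff_sub, coeff_X_mul_derivative, coeff_C_mul]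
      rcases (by omega : k - 1 = m ∨ k - 1 = m + 1 ∨ m + 1 < k - 1) with h | h | h
      · rw [h, hP, coeff_monicOP_succ hα ht]
        ring
      · rw [h]
        push_cast
        ring
      · rw [hP, coeff_monicOP_of_lt α t h]
        ring
  rw [ip_eq_cubeInt] at hPQ i1 i2 i3 i4
  have key := cubeInt_pearson hα ht (P * Q)
  have hpoly : X ^ 3 * ((1 - X ^ 2) * derivative (P * Q)) -
      C (2 * (1 + α)) * (X ^ 3 * (X * (P * Q))) + C (2 * t) * ((1 - X ^ 2) * (P * Q)) =
      X ^ 3 * (derivative Q * P) - X ^ 3 * (X * (X * derivative Q) * P) +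
      X ^ 3 * (derivative P * Q) -
      X ^ 3 * (X * (X * derivative P - C (m + 1 : ℝ) * P) * Q) -
      C (m + 1 + 2 * (1 + α)) * (X ^ 3 * (X * Q * P)) + C (2 * t) * (P * Q) -
      C (2 * t) * (X ^ 2 * (P * Q)) := by
    rw [derivative_mul]
    simp only [C_add]
    ring
  rw [hpoly] at key
  simp only [cubeInt_sub hα ht, cubeInt_add hα ht, cubeInt_C_mul] at key
  rw [hPQ, i1, i2, i3, i4, cubeInt_sq_mul_succ hα ht] at key
  have h1 := rAux_succ_mul_sqNorm hα ht m
  have h2 := recCoeff_mul_sqNorm hα ht m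
  rw [pow_succ]
  push_cast
  linear_combination key + h1 - (2 * m + 2 * α + 3) * h2

/-- Multiplying `recCoeff_mul_ladderR_sub` by R_n = r_n + r_{n+1} makes both sides telescope,
starting from β_0 = r_0 = 0. -/
theorem recCoeff_mul_ladderR_mul {α t : ℝ} (hα : 0 < α) (ht : 0 < t) (n : ℕ) :
    recCoeff α n t * ladderR α n t * ladderR α (n - 1) t = -2 * (-1) ^ n * t * rAux α n t := by
  induction n with
  | zero => simp [recCoeff, rAux]
  | succ n ih =>
    rw [Nat.add_sub_cancel, pow_succ]
    linear_combination ih + ladderR α n t * recCoeff_mul_ladderR_sub hα ht n -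
      2 * (-1) ^ n * t * rAux_add_succ hα ht n

/-- The relation for the increment of `r_n` that comes from the poles of the ladder operators
at `±1`. -/
theorem rAux_succ_sub {α t : ℝ} (hα : 0 < α) (ht : 0 < t) (n : ℕ) :
    1 + rAux α (n + 1) t - rAux α n t =
      recCoeff α (n + 1) t * (ladderR α (n + 1) t + (2 * n + 2 * α + 3)) -
      recCoeff α n t * (ladderR α (n - 1) t + (2 * n + 2 * α - 1)) := by
  have h1 := rAux_eq hα ht n
  have h2 := rAux_eq hα ht (n + 1)
  rw [Finset.sum_range_succ, pow_succ] at h2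
  push_cast at h2
  linear_combination h2 - h1 - recCoeff_mul_ladderR_sub hα ht n

/-- Telescoping again: for u_n = n + r_n, the increment of u (u + 2α) is (u_{n+1} - u_n)(u_{n+1} +
u_n + 2α), and the second factor is R_n + 2n + 2α + 1. -/
theorem recCoeff_mul_shifted {α t : ℝ} (hα : 0 < α) (ht : 0 < t) (n : ℕ) :
    recCoeff α n t * (ladderR α n t + (2 * n + 2 * α + 1)) *
      (ladderR α (n - 1) t + (2 * n + 2 * α - 1)) =
      (n + rAux α n t) * (n + rAux α n t + 2 * α) := by
  induction n with
  | zero => simp [recCoeff, rAux]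
  | succ n ih =>
    rw [Nat.add_sub_cancel]
    push_cast
    linear_combination ih - (ladderR α n t + (2 * n + 2 * α + 1)) * rAux_succ_sub hα ht n -
      (1 + rAux α (n + 1) t - rAux α n t) * rAux_add_succ hα ht n

/-! ### Evolution in t -/

/-- Separates the parameter s of the polynomial from the parameter u of the weight. -/
theorem ip_monicOP_eq_sum {α s : ℝ} (hα : 0 < α) {u : ℝ} (hu : 0 < u) (n : ℕ) (q : ℝ[X]) :
    ip α u (monicOP α s n) q =
      ∑ i ∈ Finset.range (n + 1), (monicOP α s n).coeff i * ip α u (X ^ i) q := by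
  conv_lhs => rw [(monicOP α s n).as_sum_range_C_mul_X_pow, monicOP_natDegree]
  rw [ip_sum_left hα hu]
  simp only [ip_C_mul_left]

/-- Pairing P_n(s) with the fixed monic P_n(t) gives h_n(s) under the weight at s and h_n(t) under
the weight at t. In the difference each coefficient of P_n(s) multiplies a bracket vanishing at s =
t, so the derivatives of the coefficients drop out. -/
theorem hasDerivAt_sqNorm_of_coeff {α t : ℝ} (hα : 0 < α) (ht : 0 < t) (n : ℕ)
    (h : ∀ i, DifferentiableAt ℝ (fun s => (monicOP α s n).coeff i) t) :
    HasDerivAt (fun s => sqNorm α s n)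
      (-cubeInt α t (X * (monicOP α t n * monicOP α t n))) t := by
  have h1 : HasDerivAt (fun s => sqNorm α t n + ∑ i ∈ Finset.range (n + 1),
      (monicOP α s n).coeff i * (ip α s (X ^ i) (monicOP α t n) - ip α t (X ^ i) (monicOP α t n)))
      (∑ i ∈ Finset.range (n + 1),
        (monicOP α t n).coeff i * -cubeInt α t (X * (X ^ i * monicOP α t n))) t := by
    refine HasDerivAt.const_add _ (HasDerivAt.fun_sum fun i _ => ?_)
    refine ((h i).hasDerivAt.mul
      ((hasDerivAt_ip hα ht (X ^ i) (monicOP α t n)).sub_const _)).congr_deriv ?_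
    ring
  have h2 : ∑ i ∈ Finset.range (n + 1),
      (monicOP α t n).coeff i * -cubeInt α t (X * (X ^ i * monicOP α t n)) =
      -cubeInt α t (X * (monicOP α t n * monicOP α t n)) := by
    have e1 := HasDerivAt.fun_sum (u := Finset.range (n + 1)) fun i _ =>
      (hasDerivAt_ip hα ht (X ^ i) (monicOP α t n)).const_mul ((monicOP α t n).coeff i)
    refine e1.unique ((hasDerivAt_ip hα ht (monicOP α t n) (monicOP α t n)).congr_of_eventuallyEq ?_)
    filter_upwards [Ioi_mem_nhds ht] with s hs
    rw [ip_monicOP_eq_sum hα hs]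
  rw [h2] at h1
  refine h1.congr_of_eventuallyEq ?_
  filter_upwards [Ioi_mem_nhds ht] with s hs
  have hs : 0 < s := hs
  simp only [mul_sub, Finset.sum_sub_distrib]
  rw [← ip_monicOP_eq_sum hα hs, ← ip_monicOP_eq_sum hα ht, ip_comm α s,
    ip_monicOP hα hs fun k hk => coeff_monicOP_of_lt α t hk,
    ip_monicOP hα ht fun k hk => coeff_monicOP_of_lt α s hk, coeff_monicOP_self, coeff_monicOP_self]
  ring

/-- The recurrence builds P_{n+1} from P_n, P_{n-1} and β_n, and β_n is a quotient of norms already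
known to be differentiable. -/
theorem differentiableAt_coeff_monicOP {α : ℝ} (hα : 0 < α) (n : ℕ) :
    ∀ t : ℝ, 0 < t → ∀ i, DifferentiableAt ℝ (fun s => (monicOP α s n).coeff i) t := by
  induction n using Nat.strong_induction_on with
  | _ n ih =>
    intro t ht i
    rcases n with _ | n
    · simp [monicOP_zero]
    have hβ : DifferentiableAt ℝ (recCoeff α n) t := by
      rcases n with _ | n
      · exact differentiableAt_const (0 : ℝ)
      · exact (hasDerivAt_sqNorm_of_coeff hα ht (n + 1) (ih (n + 1) (by omega) t ht)).differentiableAt.div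
          (hasDerivAt_sqNorm_of_coeff hα ht n (ih n (by omega) t ht)).differentiableAt
          (sqNorm_pos hα ht n).ne'
    have hX : DifferentiableAt ℝ (fun s => (X * monicOP α s n).coeff i) t := by
      rcases i with _ | i
      · simp
      · simpa only [coeff_X_mul] using ih n (by omega) t ht i
    refine (hX.sub (hβ.mul (ih (n - 1) (by omega) t ht i))).congr_of_eventuallyEq ?_
    filter_upwards [Ioi_mem_nhds ht] with s hs
    simp [X_mul_monicOP hα hs n]

theorem hasDerivAt_sqNorm {α t : ℝ} (hα : 0 < α) (ht : 0 < t) (n : ℕ) :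
    HasDerivAt (fun s => sqNorm α s n) (-(sqNorm α t n * ladderR α n t) / (2 * t)) t := by
  refine (hasDerivAt_sqNorm_of_coeff hα ht n
    (differentiableAt_coeff_monicOP hα n t ht)).congr_deriv ?_
  rw [sqNorm_mul_ladderR hα ht]
  field_simp

/-- The Toda equation for the recurrence coefficients. -/
theorem hasDerivAt_recCoeff {α t : ℝ} (hα : 0 < α) (ht : 0 < t) (n : ℕ) :
    HasDerivAt (recCoeff α n)
      (recCoeff α n t * (ladderR α (n - 1) t - ladderR α n t) / (2 * t)) t := by
  rcases n with _ | n
  · exact (hasDerivAt_const t (0 : ℝ)).congr_deriv (by simp [recCoeff])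
  · have h0 := (sqNorm_pos hα ht n).ne'
    refine ((hasDerivAt_sqNorm hα ht (n + 1)).div (hasDerivAt_sqNorm hα ht n) h0).congr_deriv ?_
    rw [recCoeff, Nat.add_sub_cancel]
    field_simp
    ring

/-- The Toda equation telescopes through `recCoeff_mul_ladderR_sub`, so differentiating `rAux_eq`
leaves no sum over j. -/
theorem hasDerivAt_sum_recCoeff {α t : ℝ} (hα : 0 < α) (ht : 0 < t) (n : ℕ) :
    HasDerivAt (fun s => ∑ j ∈ Finset.range n, recCoeff α j s)
      ((recCoeff α n t * ladderR α n t - (1 - (-1) ^ n) * t) / (2 * t)) t := by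
  induction n with
  | zero => simpa [recCoeff] using hasDerivAt_const t (0 : ℝ)
  | succ n ih =>
    simp only [Finset.sum_range_succ]
    refine (ih.add (hasDerivAt_recCoeff hα ht n)).congr_deriv ?_
    rw [← add_div, pow_succ]
    congr 1
    linear_combination -recCoeff_mul_ladderR_sub hα ht n

theorem hasDerivAt_rAux {α t : ℝ} (hα : 0 < α) (ht : 0 < t) (n : ℕ) :
    HasDerivAt (rAux α n) (recCoeff α n t * ((2 * n + 2 * α + 1) * ladderR α (n - 1) t -
      (2 * n + 2 * α - 1) * ladderR α n t) / (2 * t)) t := by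
  have h := ((((hasDerivAt_recCoeff hα ht n).const_mul (2 * n + 2 * α + 1)).add
    ((hasDerivAt_sum_recCoeff hα ht n).const_mul 2)).sub_const (n : ℝ)).add
    ((hasDerivAt_id t).const_mul (1 - (-1) ^ n))
  refine (h.congr_of_eventuallyEq ?_).congr_deriv ?_
  · filter_upwards [Ioi_mem_nhds ht] with s hs
    rw [rAux_eq hα hs]
    rfl
  · field_simp
    ring

/-- A Riccati equation for `R_n`. -/
theorem hasDerivAt_ladderR {α t : ℝ} (hα : 0 < α) (ht : 0 < t) (n : ℕ) :
    HasDerivAt (ladderR α n)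
      ((ladderR α n t * (1 + ladderR α n t - 2 * rAux α n t - 2 * (-1) ^ n * t) -
        2 * (-1) ^ n * t * (2 * n + 2 * α + 1)) / (2 * t)) t := by
  refine (((hasDerivAt_rAux hα ht n).add (hasDerivAt_rAux hα ht (n + 1))).congr_of_eventuallyEq
    ?_).congr_deriv ?_
  · filter_upwards [Ioi_mem_nhds ht] with s hs
    exact (rAux_add_succ hα hs n).symm
  · rw [← add_div, Nat.add_sub_cancel]
    congr 1
    have h1 := recCoeff_mul_ladderR_sub hα ht n
    have h2 := rAux_succ_sub hα ht n
    have h3 := rAux_add_succ hα ht n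
    push_cast
    linear_combination -(2 * n + 2 * α + 1) * h1 - ladderR α n t * h2 - ladderR α n t * h1 +
      ladderR α n t * h3

/-! ### Elimination of S and the differential equation -/

/-- The second derivative of `r_n`, where `S = β_n ((2n+2α+1) R_{n-1} + (2n+2α-1) R_n)`. -/
theorem exists_hasDerivAt_deriv_rAux {α t : ℝ} (hα : 0 < α) (ht : 0 < t) (n : ℕ) :
    ∃ S r₂ : ℝ, HasDerivAt (deriv (rAux α n)) r₂ t ∧
      2 * t ^ 2 * r₂ + t * deriv (rAux α n) t =
        S * (rAux α n t - (-1) ^ n * t) + 2 * (-1) ^ n * t * ((2 * n + 2 * α) * rAux α n t +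
          ((n + rAux α n t) * (n + rAux α n t + 2 * α) + 2 * (-1) ^ n * t * rAux α n t)) ∧
      S ^ 2 - 4 * t ^ 2 * deriv (rAux α n) t ^ 2 = -8 * (-1) ^ n * t * rAux α n t *
        ((n + rAux α n t) * (n + rAux α n t + 2 * α) + 2 * (-1) ^ n * t * rAux α n t - S) := by
  rcases n with _ | m
  · have h : rAux α 0 = fun _ => 0 := rfl
    exact ⟨0, 0, by simpa [h] using hasDerivAt_const t (0 : ℝ), by simp [h], by simp [h]⟩
  have hR := hasDerivAt_ladderR hα ht (m + 1)
  have hR' := hasDerivAt_ladderR hα ht m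
  have hβ := hasDerivAt_recCoeff hα ht (m + 1)
  have e1 := recCoeff_mul_ladderR_mul hα ht (m + 1)
  have e2 := recCoeff_mul_shifted hα ht (m + 1)
  have e3 := rAux_add_succ hα ht m
  have hd : deriv (rAux α (m + 1)) t = _ := (hasDerivAt_rAux hα ht (m + 1)).deriv
  have hD := (hβ.mul ((hR'.const_mul (2 * ((m + 1 : ℕ) : ℝ) + 2 * α + 1)).sub
    (hR.const_mul (2 * ((m + 1 : ℕ) : ℝ) + 2 * α - 1)))).div ((hasDerivAt_id t).const_mul 2)
    (by positivity)
  have hD' := hD.congr_of_eventuallyEq (f₁ := deriv (rAux α (m + 1))) (by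
    filter_upwards [Ioi_mem_nhds ht] with s hs
    exact (hasDerivAt_rAux hα hs (m + 1)).deriv)
  refine ⟨recCoeff α (m + 1) t * ((2 * ((m + 1 : ℕ) : ℝ) + 2 * α + 1) * ladderR α m t +
    (2 * ((m + 1 : ℕ) : ℝ) + 2 * α - 1) * ladderR α (m + 1) t), _, hD', ?_, ?_⟩
  · rw [hd]
    simp only [Nat.add_sub_cancel, Pi.mul_apply, Pi.sub_apply, id] at e1 e2 ⊢
    -- Replacing r_m by R_m - r_{m+1} leaves only β_{m+1}, R_{m+1}, R_m and r_{m+1}.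
    rw [eq_sub_of_add_eq e3]
    rw [pow_succ (-1 : ℝ) m] at e1 ⊢
    clear hR hR' hβ hd hD hD' e3
    generalize recCoeff α (m + 1) t = β at *
    generalize ladderR α (m + 1) t = R at *
    generalize ladderR α m t = R' at *
    generalize rAux α (m + 1) t = r at *
    generalize (-1 : ℝ) ^ m = s at *
    push_cast at *
    field_simp
    linear_combination (-2 * (2 * (m + 1) + 2 * α) + 4 * s * t) * e1 - 4 * s * t * e2
  · have h2 : 2 * t * deriv (rAux α (m + 1)) t =
        recCoeff α (m + 1) t * ((2 * ((m + 1 : ℕ) : ℝ) + 2 * α + 1) * ladderR α m t -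
          (2 * ((m + 1 : ℕ) : ℝ) + 2 * α - 1) * ladderR α (m + 1) t) := by
      rw [hd, Nat.add_sub_cancel]
      field_simp
    rw [show 4 * t ^ 2 * deriv (rAux α (m + 1)) t ^ 2 = (2 * t * deriv (rAux α (m + 1)) t) ^ 2 by
      ring, h2]
    simp only [Nat.add_sub_cancel] at e1 e2 ⊢
    push_cast at e1 e2 ⊢
    generalize (-1 : ℝ) ^ (m + 1) = s at *
    linear_combination (4 * recCoeff α (m + 1) t * ((2 * (m + 1) + 2 * α) ^ 2 - 1) +
      8 * s * t * rAux α (m + 1) t) * e1 - 8 * s * t * rAux α (m + 1) t * e2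

theorem quadratic_ode_of_relations {n α s t r r₁ r₂ S : ℝ} (hs : s ^ 2 = 1) (ht : t ≠ 0)
    (h1 : 2 * t ^ 2 * r₂ + t * r₁ = S * (r - s * t) + 2 * s * t * ((2 * n + 2 * α) * r +
      ((n + r) * (n + r + 2 * α) + 2 * s * t * r)))
    (h2 : S ^ 2 - 4 * t ^ 2 * r₁ ^ 2 =
      -8 * s * t * r * ((n + r) * (n + r + 2 * α) + 2 * s * t * r - S)) :
    4 * t ^ 3 * r₂ ^ 2
      + 4 * t ^ 2 * (r₁ - 2 * s * (3 * r ^ 2 + 4 * (n + α) * r + n * (n + 2 * α))) * r₂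
      - t * (4 * r ^ 2 - 8 * s * t * r + 4 * t ^ 2 - 1) * r₁ ^ 2
      - 4 * s * t * (3 * r ^ 2 + 4 * (n + α) * r + n * (n + 2 * α)) * r₁
      + 8 * s * r ^ 5
      + 4 * (4 * s * (n + α) + 5 * t) * r ^ 4
      + 8 * (s * (n ^ 2 + 2 * n * α + t ^ 2) + 8 * t * (n + α)) * r ^ 3
      + 8 * t * (2 * s * t * (n + α) + (3 * n + 2 * α) * (3 * n + 4 * α)) * r ^ 2
      + 8 * n * (n + 2 * α) * t * (4 * n + 4 * α + s * t) * r
      + 4 * n ^ 2 * (n + 2 * α) ^ 2 * t = 0 := by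
  -- The squared relation below is t times the equation.
  apply mul_left_cancel₀ ht
  have hs3 : s ^ 3 = s := by linear_combination s * hs
  have hW : S * (r - s * t) = 2 * t ^ 2 * r₂ + t * r₁ - 2 * s * t * ((2 * n + 2 * α) * r +
      ((n + r) * (n + r + 2 * α) + 2 * s * t * r)) := by
    linear_combination -h1
  -- Completing the square in `h2` and multiplying by (r - s t)² leaves S only in the product S (r -
  -- s t), which `hW` replaces. There is no division, so r = s t needs no separate case.
  have key : (S * (r - s * t) - 4 * s * t * r * (r - s * t)) ^ 2 = (r - s * t) ^ 2 *
      (4 * t ^ 2 * r₁ ^ 2 - 8 * s * t * r * ((n + r) * (n + r + 2 * α) + 2 * s * t * r) +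
        16 * s ^ 2 * t ^ 2 * r ^ 2) := by
    linear_combination (r - s * t) ^ 2 * h2
  rw [hW] at key
  ring_nf at key ⊢
  simp only [hs, hs3] at key ⊢
  linear_combination key

end SingJacobi

end

theorem theorem3p3 (α : ℝ) (hα : 0 < α) (n : ℕ) (t : ℝ) (ht : 0 < t) :
    DifferentiableAt ℝ (SingJacobi.rAux α n) t ∧
    DifferentiableAt ℝ (deriv (SingJacobi.rAux α n)) t ∧
    (let r : ℝ := SingJacobi.rAux α n t
     let r' : ℝ := deriv (SingJacobi.rAux α n) t
     let r'' : ℝ := deriv (deriv (SingJacobi.rAux α n)) t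
     4 * t ^ 3 * r'' ^ 2
      + 4 * t ^ 2 * (r' - 2 * (-1) ^ n * (3 * r ^ 2 + 4 * (n + α) * r + n * (n + 2 * α))) * r''
      - t * (4 * r ^ 2 - 8 * (-1) ^ n * t * r + 4 * t ^ 2 - 1) * r' ^ 2
      - 4 * (-1) ^ n * t * (3 * r ^ 2 + 4 * (n + α) * r + n * (n + 2 * α)) * r'
      + 8 * (-1) ^ n * r ^ 5
      + 4 * (4 * (-1) ^ n * (n + α) + 5 * t) * r ^ 4
      + 8 * ((-1) ^ n * (n ^ 2 + 2 * n * α + t ^ 2) + 8 * t * (n + α)) * r ^ 3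
      + 8 * t * (2 * (-1) ^ n * t * (n + α) + (3 * n + 2 * α) * (3 * n + 4 * α)) * r ^ 2
      + 8 * n * (n + 2 * α) * t * (4 * n + 4 * α + (-1) ^ n * t) * r
      + 4 * n ^ 2 * (n + 2 * α) ^ 2 * t = 0) := by
  obtain ⟨S, r₂, h₂, e1, e2⟩ := SingJacobi.exists_hasDerivAt_deriv_rAux hα ht n
  refine ⟨(SingJacobi.hasDerivAt_rAux hα ht n).differentiableAt, h₂.differentiableAt, ?_⟩
  rw [h₂.deriv]
  have hs : ((-1 : ℝ) ^ n) ^ 2 = 1 := by rw [← pow_mul, mul_comm, pow_mul]; norm_num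
  exact SingJacobi.quadratic_ode_of_relations hs ht.ne' e1 e2
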